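/- Let $\mathcal H$ be a complex Hilbert space and let $A_1,\dots,A_N$ be finitely many bounded self-adjoint operators on $\mathcal H$ such that $A_iA_j$ is compact for all $i\neq j$. Put $A=\sum_{i=1}^N A_i$. For a bounded self-adjoint operator $B$ on $\mathcal H$ let $E_B$ denote its projection-valued spectral measure on the Borel subsets of $\mathbb R$, so that $B=\int_{\mathbb R} t\,dE_B(t)$, and let the essential spectrum $\sigma_e(B)$ be the set of all $\lambda$ in the spectrum $\sigma(B)$ such that $\lambda$ is a limit point of $\sigma(B)$ or $\ker(B-\lambda I)$ is infinite dimensional. For $\varepsilon>0$ put $$\mathcal H_\varepsilon=\bigcap_{i=1}^N E_{A_i}([-\varepsilon,\varepsilon])\mathcal H .$$ Then $0\in\sigma_e(A)$ if and only if the subspace $\mathcal H_\varepsilon$ is infinite dimensional for every $\varepsilon>0$. -/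

import Mathlib

open MeasureTheory Filter Topology Set
open scoped CompactlySupported InnerProductSpace NNReal

noncomputable section

namespace SpectralSum

/-- The essential spectrum of a bounded (self-adjoint) operator: the points of the spectrum that
are limit points of the spectrum or eigenvalues of infinite multiplicity. -/
def essentialSpectrum {H : Type*} [NormedAddCommGroup H] [InnerProductSpace ℂ H]
    (A : H →L[ℂ] H) : Set ℂ :=
  {z | z ∈ spectrum ℂ A ∧
    (AccPt z (𝓟 (spectrum ℂ A)) ∨
      ¬ FiniteDimensional ℂ (LinearMap.ker (A - z • (1 : H →L[ℂ] H)).toLinearMap))}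

/-- A projection-valued (spectral) measure on the Borel subsets of `ℝ`. -/
structure ProjectionValuedMeasure (H : Type*) [NormedAddCommGroup H] [InnerProductSpace ℂ H]
    [CompleteSpace H] where
  /-- the orthogonal projection `E(S)` (meaningful for Borel sets `S`) -/
  proj : Set ℝ → H →L[ℂ] H
  isStarProjection : ∀ S, MeasurableSet S → IsStarProjection (proj S)
  univ : proj Set.univ = 1
  hasSum_iUnion : ∀ S : ℕ → Set ℝ, (∀ n, MeasurableSet (S n)) →
    Pairwise (Function.onFun Disjoint S) → ∀ x, HasSum (fun n => proj (S n) x) (proj (⋃ n, S n) x)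

section Construction

variable {H : Type*} [NormedAddCommGroup H] [InnerProductSpace ℂ H] [CompleteSpace H]

/-- The positive functional `f ↦ ⟪f(A) x, x⟫` on the continuous functions on the spectrum. -/
def spectralFunctional (A : H →L[ℂ] H) (hA : IsSelfAdjoint A) (x : H) :
    C_c(spectrum ℝ A, ℝ) →ₚ[ℝ] ℝ :=
  PositiveLinearMap.mk₀
    { toFun := fun f => (⟪cfcHom hA f.toContinuousMap x, x⟫_ℂ).re
      map_add' := fun f g => by
        have : (f + g).toContinuousMap = f.toContinuousMap + g.toContinuousMap := rfl
        rw [this, map_add]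
        simp
      map_smul' := fun c f => by
        have : (c • f).toContinuousMap = c • f.toContinuousMap := rfl
        rw [this, map_smul]
        simp [inner_smul_left_eq_smul] }
    (fun f hf => by
      have h0 : 0 ≤ cfcHom hA f.toContinuousMap := by
        rw [cfcHom_nonneg_iff]
        intro t
        exact hf t
      have := ((ContinuousLinearMap.nonneg_iff_isPositive _).1 h0).re_inner_nonneg_left x
      simpa using this)

/-- The scalar spectral measure of `A` at `x`: the measure on the spectrum that represents
`f ↦ ⟪f(A) x, x⟫`. -/
def scalarSpectralMeasure (A : H →L[ℂ] H) (hA : IsSelfAdjoint A) (x : H) :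
    Measure (spectrum ℝ A) :=
  RealRMK.rieszMeasure (spectralFunctional A hA x)

instance (A : H →L[ℂ] H) (hA : IsSelfAdjoint A) (x : H) :
    (scalarSpectralMeasure A hA x).Regular := by
  unfold scalarSpectralMeasure; infer_instance

instance (A : H →L[ℂ] H) (hA : IsSelfAdjoint A) (x : H) :
    IsFiniteMeasure (scalarSpectralMeasure A hA x) :=
  ⟨isCompact_univ.measure_lt_top⟩

theorem integral_scalarSpectralMeasure (A : H →L[ℂ] H) (hA : IsSelfAdjoint A) (x : H)
    (f : C(spectrum ℝ A, ℝ)) :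
    ∫ t, f t ∂(scalarSpectralMeasure A hA x) = (⟪cfcHom hA f x, x⟫_ℂ).re :=
  RealRMK.integral_rieszMeasure (spectralFunctional A hA x)
    (CompactlySupportedContinuousMap.continuousMapEquiv f)

theorem integral_scalarSpectralMeasure' (A : H →L[ℂ] H) (hA : IsSelfAdjoint A) (x : H)
    (f : C(spectrum ℝ A, ℝ)) :
    ((∫ t, f t ∂(scalarSpectralMeasure A hA x) : ℝ) : ℂ) = ⟪cfcHom hA f x, x⟫_ℂ := by
  have h1 : IsSelfAdjoint (cfcHom hA f) := cfcHom_predicate hA f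
  have h2 := h1.isSymmetric.coe_re_inner_apply_self x
  rw [integral_scalarSpectralMeasure]
  simpa using h2

theorem integral_sq_scalarSpectralMeasure (A : H →L[ℂ] H) (hA : IsSelfAdjoint A) (x : H)
    (f : C(spectrum ℝ A, ℝ)) :
    ∫ t, (f t) ^ 2 ∂(scalarSpectralMeasure A hA x) = ‖cfcHom hA f x‖ ^ 2 := by
  have h1 : IsSelfAdjoint (cfcHom hA f) := cfcHom_predicate hA f
  have h := integral_scalarSpectralMeasure A hA x (f * f)
  have h3 : ⟪cfcHom hA f (cfcHom hA f x), x⟫_ℂ = ⟪cfcHom hA f x, cfcHom hA f x⟫_ℂ :=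
    h1.isSymmetric _ _
  rw [map_mul, mul_apply_eq_comp, h3] at h
  simp only [pow_two, ContinuousMap.mul_apply] at h ⊢
  rw [h, ← pow_two, ← inner_self_eq_norm_sq (𝕜 := ℂ)]
  rfl

theorem scalarSpectralMeasure_univ (A : H →L[ℂ] H) (hA : IsSelfAdjoint A) (x : H) :
    (scalarSpectralMeasure A hA x).real univ = ‖x‖ ^ 2 := by
  have h := integral_sq_scalarSpectralMeasure A hA x 1
  simpa using h

/-- `T` is the operator that represents the indicator function of `S`. -/
def Represents (A : H →L[ℂ] H) (hA : IsSelfAdjoint A) (S : Set (spectrum ℝ A))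
    (T : H →L[ℂ] H) : Prop :=
  IsStarProjection T ∧ ∀ x, ⟪T x, x⟫_ℂ = ((scalarSpectralMeasure A hA x).real S : ℂ)

theorem isStarProjection_of_norm_sq (T : H →L[ℂ] H)
    (h : ∀ x, ⟪T x, x⟫_ℂ = ((‖T x‖ ^ 2 : ℝ) : ℂ)) : IsStarProjection T := by
  have key : star T * T = T := by
    apply ContinuousLinearMap.coe_injective
    rw [← ext_inner_map]
    intro x
    have : ⟪(star T * T) x, x⟫_ℂ = ⟪T x, T x⟫_ℂ := ContinuousLinearMap.adjoint_inner_left T x (T x)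
    change ⟪(star T * T) x, x⟫_ℂ = ⟪T x, x⟫_ℂ
    rw [this, h x, inner_self_eq_norm_sq_to_K]
    simp
  have hs : IsSelfAdjoint T := by
    rw [← key]; exact IsSelfAdjoint.star_mul_self T
  refine ⟨?_, hs⟩
  rw [hs.star_eq] at key
  exact key

theorem inner_eq_norm_sq_of_isStarProjection {T : H →L[ℂ] H} (hT : IsStarProjection T) (x : H) :
    ⟪T x, x⟫_ℂ = ((‖T x‖ ^ 2 : ℝ) : ℂ) := by
  have h1 : T (T x) = T x := DFunLike.congr_fun hT.isIdempotentElem x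
  have h2 : ⟪T (T x), x⟫_ℂ = ⟪T x, T x⟫_ℂ := hT.isSelfAdjoint.isSymmetric _ _
  rw [h1] at h2
  rw [h2, inner_self_eq_norm_sq_to_K]
  simp

theorem Represents.norm_sq {A : H →L[ℂ] H} {hA : IsSelfAdjoint A} {S : Set (spectrum ℝ A)}
    {T : H →L[ℂ] H} (h : Represents A hA S T) (x : H) :
    ‖T x‖ ^ 2 = (scalarSpectralMeasure A hA x).real S := by
  have h1 := inner_eq_norm_sq_of_isStarProjection h.1 x
  rw [h.2 x] at h1
  exact_mod_cast h1.symm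

theorem Represents.unique {A : H →L[ℂ] H} {hA : IsSelfAdjoint A} {S : Set (spectrum ℝ A)}
    {T T' : H →L[ℂ] H} (h : Represents A hA S T) (h' : Represents A hA S T') : T = T' := by
  apply ContinuousLinearMap.coe_injective
  rw [← ext_inner_map]
  intro x
  exact (h.2 x).trans (h'.2 x).symm

theorem represents_of_tendsto (A : H →L[ℂ] H) (hA : IsSelfAdjoint A) (S : Set (spectrum ℝ A))
    (T : ℕ → H →L[ℂ] H) (hC : ∀ x, CauchySeq fun n => T n x)
    (h1 : ∀ x, Tendsto (fun n => ⟪T n x, x⟫_ℂ) atTop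
      (𝓝 ((scalarSpectralMeasure A hA x).real S : ℂ)))
    (h2 : ∀ x, Tendsto (fun n => ‖T n x‖ ^ 2) atTop
      (𝓝 ((scalarSpectralMeasure A hA x).real S))) :
    ∃ T' : H →L[ℂ] H, Represents A hA S T' ∧ ∀ x, Tendsto (fun n => T n x) atTop (𝓝 (T' x)) := by
  choose g hg using fun x => cauchySeq_tendsto_of_complete (hC x)
  let T' : H →L[ℂ] H := continuousLinearMapOfTendsto T (f := g) (tendsto_pi_nhds.2 hg)
  have hT' : ∀ x, Tendsto (fun n => T n x) atTop (𝓝 (T' x)) := hg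
  have e1 : ∀ x, ⟪T' x, x⟫_ℂ = ((scalarSpectralMeasure A hA x).real S : ℂ) := fun x =>
    tendsto_nhds_unique ((hT' x).inner tendsto_const_nhds) (h1 x)
  have e2 : ∀ x, ‖T' x‖ ^ 2 = (scalarSpectralMeasure A hA x).real S := fun x =>
    tendsto_nhds_unique ((hT' x).norm.pow 2) (h2 x)
  refine ⟨T', ⟨isStarProjection_of_norm_sq T' fun x => ?_, e1⟩, hT'⟩
  rw [e1, e2]

theorem exists_represents_isClosed (A : H →L[ℂ] H) (hA : IsSelfAdjoint A)
    (F : Set (spectrum ℝ A)) (hF : IsClosed F) : ∃ T, Represents A hA F T := by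
  let f : ℕ → C(spectrum ℝ A, ℝ) := fun n =>
    ⟨fun t => (hF.apprSeq n t : ℝ), NNReal.continuous_coe.comp (hF.apprSeq n).continuous⟩
  have f0 : ∀ n t, 0 ≤ f n t := fun n t => NNReal.coe_nonneg _
  have f1 : ∀ n t, f n t ≤ 1 := fun n t => by
    exact_mod_cast HasOuterApproxClosed.apprSeq_apply_le_one hF n t
  have ft : ∀ t, Tendsto (fun n => f n t) atTop (𝓝 (F.indicator (fun _ => (1 : ℝ)) t)) := by
    intro t
    have h := tendsto_pi_nhds.1 (HasOuterApproxClosed.tendsto_apprSeq hF) t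
    have h' := (NNReal.continuous_coe.tendsto _).comp h
    have e : ((F.indicator (fun _ => (1 : ℝ≥0)) t : ℝ≥0) : ℝ)
        = F.indicator (fun _ => (1 : ℝ)) t := by
      by_cases ht : t ∈ F <;> simp [ht]
    rw [← e]
    exact h'
  have fsq : ∀ n t, (f n t) ^ 2 ≤ 1 := fun n t => pow_le_one₀ (f0 n t) (f1 n t)
  have hind : ∀ x, ∫ t, F.indicator (fun _ => (1 : ℝ)) t ∂(scalarSpectralMeasure A hA x)
      = (scalarSpectralMeasure A hA x).real F := fun x => by
    rw [integral_indicator_const _ hF.measurableSet]; simp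
  refine (represents_of_tendsto A hA F (fun n => cfcHom hA (f n)) ?_ ?_ ?_).imp fun T hT => hT.1
  · intro x
    rw [cauchySeq_iff_tendsto_dist_atTop_0]
    have e : ∀ p : ℕ × ℕ, dist (cfcHom hA (f p.1) x) (cfcHom hA (f p.2) x)
        = √(∫ t, (f p.1 t - f p.2 t) ^ 2 ∂(scalarSpectralMeasure A hA x)) := by
      intro p
      have h := integral_sq_scalarSpectralMeasure A hA x (f p.1 - f p.2)
      simp only [ContinuousMap.sub_apply] at h
      rw [h, Real.sqrt_sq (norm_nonneg _), dist_eq_norm, map_sub, _root_.sub_apply]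
    simp only [e]
    have h0 : Tendsto (fun p : ℕ × ℕ => ∫ t, (f p.1 t - f p.2 t) ^ 2
        ∂(scalarSpectralMeasure A hA x)) atTop
        (𝓝 (∫ _t, (0 : ℝ) ∂(scalarSpectralMeasure A hA x))) := by
      apply tendsto_integral_filter_of_dominated_convergence (fun _ => (1 : ℝ))
      · exact Eventually.of_forall fun p => (by fun_prop : Continuous fun t =>
          (f p.1 t - f p.2 t) ^ 2).aestronglyMeasurable
      · refine Eventually.of_forall fun p => Eventually.of_forall fun t => ?_
        rw [Real.norm_of_nonneg (sq_nonneg _)]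
        have := f0 p.1 t; have := f0 p.2 t; have := f1 p.1 t; have := f1 p.2 t
        rw [sq_le_one_iff_abs_le_one, abs_le]
        constructor <;> linarith
      · exact integrable_const _
      · refine Eventually.of_forall fun t => ?_
        rw [← prod_atTop_atTop_eq]
        have := (((ft t).comp tendsto_fst).sub ((ft t).comp (tendsto_snd (f := atTop)))).pow 2
        simpa using this
    have := (Real.continuous_sqrt.tendsto _).comp h0
    simpa [Function.comp_def] using this
  · intro x
    have h : Tendsto (fun n => ∫ t, f n t ∂(scalarSpectralMeasure A hA x)) atTop
        (𝓝 (∫ t, F.indicator (fun _ => (1 : ℝ)) t ∂(scalarSpectralMeasure A hA x))) := by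
      apply tendsto_integral_of_dominated_convergence (fun _ => (1 : ℝ))
      · exact fun n => (f n).continuous.aestronglyMeasurable
      · exact integrable_const _
      · refine fun n => Eventually.of_forall fun t => ?_
        rw [Real.norm_of_nonneg (f0 n t)]; exact f1 n t
      · exact Eventually.of_forall ft
    rw [hind] at h
    simp only [← integral_scalarSpectralMeasure']
    exact (Complex.continuous_ofReal.tendsto _).comp h
  · intro x
    have h : Tendsto (fun n => ∫ t, (f n t) ^ 2 ∂(scalarSpectralMeasure A hA x)) atTop
        (𝓝 (∫ t, F.indicator (fun _ => (1 : ℝ)) t ∂(scalarSpectralMeasure A hA x))) := by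
      apply tendsto_integral_of_dominated_convergence (fun _ => (1 : ℝ))
      · exact fun n => ((f n).continuous.pow 2).aestronglyMeasurable
      · exact integrable_const _
      · refine fun n => Eventually.of_forall fun t => ?_
        rw [Real.norm_of_nonneg (sq_nonneg _)]; exact fsq n t
      · refine Eventually.of_forall fun t => ?_
        have := (ft t).pow 2
        by_cases ht : t ∈ F <;> simpa [ht] using this
    rw [hind] at h
    simpa only [integral_sq_scalarSpectralMeasure] using h

theorem represents_iUnion (A : H →L[ℂ] H) (hA : IsSelfAdjoint A) (S : ℕ → Set (spectrum ℝ A))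
    (hS : ∀ n, MeasurableSet (S n)) (hd : Pairwise (Function.onFun Disjoint S))
    (T : ℕ → H →L[ℂ] H) (hT : ∀ n, Represents A hA (S n) (T n)) :
    ∃ T', Represents A hA (⋃ n, S n) T' ∧ ∀ x, HasSum (fun n => T n x) (T' x) := by
  have horth : ∀ i j, i ≠ j → ∀ x, T i (T j x) = 0 := by
    intro i j hij x
    have h1 := (hT i).norm_sq (T j x)
    have h2 := (hT j).norm_sq (T j x)
    have h3 : T j (T j x) = T j x := DFunLike.congr_fun (hT j).1.isIdempotentElem x
    have h4 := measureReal_union (μ := scalarSpectralMeasure A hA (T j x)) (hd hij) (hS j)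
    have h5 := measureReal_mono (μ := scalarSpectralMeasure A hA (T j x))
      (subset_univ (S i ∪ S j))
    rw [scalarSpectralMeasure_univ, h4, ← h1, ← h2, h3] at h5
    have : ‖T i (T j x)‖ ^ 2 = 0 := le_antisymm (by linarith) (sq_nonneg _)
    simpa using this
  have horth' : ∀ i j, i ≠ j → ∀ x y, ⟪T i x, T j y⟫_ℂ = 0 := by
    intro i j hij x y
    have : ⟪T i x, T j y⟫_ℂ = ⟪x, T i (T j y)⟫_ℂ := (hT i).1.isSelfAdjoint.isSymmetric x (T j y)
    rw [this, horth i j hij, inner_zero_right]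
  have hmeas : ∀ x, HasSum (fun n => (scalarSpectralMeasure A hA x).real (S n))
      ((scalarSpectralMeasure A hA x).real (⋃ n, S n)) := fun x => by
    have h := measure_iUnion (μ := scalarSpectralMeasure A hA x) hd hS
    have hne : ∑' n, (scalarSpectralMeasure A hA x) (S n) ≠ ⊤ := h ▸ measure_ne_top _ _
    have h2 := (ENNReal.summable_toReal hne).hasSum
    rw [← ENNReal.tsum_toReal_eq (fun n => measure_ne_top _ _), ← h] at h2
    exact h2
  have hsum : ∀ x, Summable fun n => T n x := by
    intro x
    have hV : OrthogonalFamily ℂ (fun n => LinearMap.range (T n).toLinearMap)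
        (fun n => (LinearMap.range (T n).toLinearMap).subtypeₗᵢ) := by
      rintro i j hij ⟨_, ⟨v, rfl⟩⟩ ⟨_, ⟨w, rfl⟩⟩
      exact horth' i j hij v w
    refine (hV.summable_iff_norm_sq_summable (fun n => ⟨T n x, ⟨x, rfl⟩⟩)).2 ?_
    simpa [(hT _).norm_sq] using (hmeas x).summable
  have hP : ∀ n x, ⟪(∑ i ∈ Finset.range n, T i) x, x⟫_ℂ
      = ((∑ i ∈ Finset.range n, (scalarSpectralMeasure A hA x).real (S i) : ℝ) : ℂ) := by
    intro n x
    rw [_root_.sum_apply, sum_inner]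
    push_cast
    exact Finset.sum_congr rfl fun i _ => (hT i).2 x
  have hP2 : ∀ n x, ‖(∑ i ∈ Finset.range n, T i) x‖ ^ 2
      = ∑ i ∈ Finset.range n, (scalarSpectralMeasure A hA x).real (S i) := by
    intro n x
    have hsp : IsStarProjection (∑ i ∈ Finset.range n, T i) := by
      apply IsStarProjection.mk
      · change _ * _ = _
        rw [Finset.sum_mul_sum]
        refine Finset.sum_congr rfl fun i hi => ?_
        rw [Finset.sum_eq_single i]
        · exact (hT i).1.isIdempotentElem
        · intro j _ hji
          ext y
          exact horth i j hji.symm y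
        · exact fun h => absurd hi h
      · exact isSelfAdjoint_sum _ fun i _ => (hT i).1.isSelfAdjoint
    have h1 := inner_eq_norm_sq_of_isStarProjection hsp x
    rw [hP] at h1
    exact_mod_cast h1.symm
  obtain ⟨T', hT', hlim⟩ := represents_of_tendsto A hA (⋃ n, S n)
    (fun n => ∑ i ∈ Finset.range n, T i)
    (fun x => by
      simpa only [_root_.sum_apply] using
        (hsum x).hasSum.tendsto_sum_nat.cauchySeq)
    (fun x => by
      simp only [hP]
      exact (Complex.continuous_ofReal.tendsto _).comp (hmeas x).tendsto_sum_nat)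
    (fun x => by
      simp only [hP2]
      exact (hmeas x).tendsto_sum_nat)
  refine ⟨T', hT', fun x => ?_⟩
  have h := (hsum x).hasSum
  have h2 := hlim x
  simp only [_root_.sum_apply] at h2
  rwa [tendsto_nhds_unique h.tendsto_sum_nat h2] at h

theorem represents_univ (A : H →L[ℂ] H) (hA : IsSelfAdjoint A) :
    Represents A hA univ 1 := by
  refine ⟨IsStarProjection.one _, fun x => ?_⟩
  rw [scalarSpectralMeasure_univ, one_apply_eq_self, inner_self_eq_norm_sq_to_K]
  simp

theorem exists_represents (A : H →L[ℂ] H) (hA : IsSelfAdjoint A)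
    (S : Set (spectrum ℝ A)) (hS : MeasurableSet S) : ∃ T, Represents A hA S T := by
  refine MeasurableSpace.induction_on_inter (C := fun S _ => ∃ T, Represents A hA S T)
    (BorelSpace.measurable_eq.trans borel_eq_generateFrom_isClosed) isPiSystem_isClosed
    ?_ ?_ ?_ ?_ S hS
  · exact ⟨0, IsStarProjection.zero _, fun x => by simp⟩
  · exact fun F hF => exists_represents_isClosed A hA F hF
  · rintro S hS ⟨T, hT⟩
    refine ⟨1 - T, hT.1.one_sub, fun x => ?_⟩
    rw [_root_.sub_apply, inner_sub_left, hT.2, (represents_univ A hA).2,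
      measureReal_compl hS]
    push_cast
    rfl
  · intro S hd hS h
    choose T hT using h
    obtain ⟨T', hT', -⟩ := represents_iUnion A hA S hS hd T hT
    exact ⟨T', hT'⟩

open Classical in
/-- For Borel `S`, the unique orthogonal projection `P` with
`⟪P x, x⟫ = μ_x(S)` for all `x`, where `μ_x` is the scalar spectral measure of `A` at `x`. -/
def spectralProjection (A : H →L[ℂ] H) (hA : IsSelfAdjoint A) (S : Set (spectrum ℝ A)) :
    H →L[ℂ] H :=
  if hS : MeasurableSet S then (exists_represents A hA S hS).choose else 0

theorem represents_spectralProjection (A : H →L[ℂ] H) (hA : IsSelfAdjoint A)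
    (S : Set (spectrum ℝ A)) (hS : MeasurableSet S) :
    Represents A hA S (spectralProjection A hA S) := by
  rw [spectralProjection, dif_pos hS]
  exact (exists_represents A hA S hS).choose_spec

/-- The spectral measure `E_A` of a bounded self-adjoint operator `A`. -/
def spectralMeasure (A : H →L[ℂ] H) (hA : IsSelfAdjoint A) : ProjectionValuedMeasure H where
  proj S := spectralProjection A hA (Subtype.val ⁻¹' S)
  isStarProjection S hS :=
    (represents_spectralProjection A hA _ (measurable_subtype_coe hS)).1
  univ := (represents_spectralProjection A hA _ (measurable_subtype_coe .univ)).unique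
    (represents_univ A hA)
  hasSum_iUnion S hS hd x := by
    obtain ⟨T', hT', h⟩ := represents_iUnion A hA (fun n => Subtype.val ⁻¹' S n)
      (fun n => measurable_subtype_coe (hS n))
      (fun i j hij => (hd hij).preimage _) _
      (fun n => represents_spectralProjection A hA _ (measurable_subtype_coe (hS n)))
    have hm : MeasurableSet (⋃ n, (Subtype.val ⁻¹' S n : Set (spectrum ℝ A))) :=
      .iUnion fun n => measurable_subtype_coe (hS n)
    rw [preimage_iUnion, (represents_spectralProjection A hA _ hm).unique hT']
    exact h x

/-- `A = ∫ t dE_A(t)`: for every `x`, the set function `S ↦ ⟪E_A(S) x, x⟫` is a finite Borel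
measure on `ℝ` carried by the spectrum of `A`, with first moment `⟪A x, x⟫`. -/
theorem spectralMeasure_spec (A : H →L[ℂ] H) (hA : IsSelfAdjoint A) (x : H) :
    ∃ μ : Measure ℝ, IsFiniteMeasure μ ∧ μ (spectrum ℝ A)ᶜ = 0 ∧
      (∀ S, MeasurableSet S → ⟪(spectralMeasure A hA).proj S x, x⟫_ℂ = (μ.real S : ℂ)) ∧
      Integrable (fun t => t) μ ∧ ⟪A x, x⟫_ℂ = ((∫ t, t ∂μ : ℝ) : ℂ) := by
  have hK : MeasurableSet (spectrum ℝ A) := (spectrum.isCompact A).measurableSet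
  refine ⟨(scalarSpectralMeasure A hA x).map Subtype.val, inferInstance, ?_, ?_, ?_, ?_⟩
  · rw [Measure.map_apply measurable_subtype_coe hK.compl]
    simp
  · intro S hS
    rw [map_measureReal_apply measurable_subtype_coe hS]
    exact (represents_spectralProjection A hA _ (measurable_subtype_coe hS)).2 x
  · rw [integrable_map_measure (by fun_prop) (by fun_prop)]
    exact (ContinuousMap.restrict (spectrum ℝ A) (.id ℝ)).continuous.integrable_of_hasCompactSupport
      (HasCompactSupport.of_compactSpace _)
  · rw [integral_map (by fun_prop) (by fun_prop)]
    have h := integral_scalarSpectralMeasure' A hA x (ContinuousMap.restrict (spectrum ℝ A) (.id ℝ))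
    rw [cfcHom_id hA] at h
    exact h.symm

/-- The subspace `H_ε = ⋂ᵢ E_{Aᵢ}([-ε, ε]) H`. -/
def commonSpectralSubspace {N : ℕ} (A : Fin N → H →L[ℂ] H) (hA : ∀ i, IsSelfAdjoint (A i))
    (ε : ℝ) : Submodule ℂ H :=
  ⨅ i, LinearMap.range ((spectralMeasure (A i) (hA i)).proj (Icc (-ε) ε)).toLinearMap

end Construction

end SpectralSum

end

/-! Write `A = ∑ Aᵢ`. Both directions go through a Weyl-type criterion: `0 ∈ σ_e(A)` iff for every
`δ > 0` some infinite-dimensional subspace satisfies `‖A x‖ ≤ δ ‖x‖` (`HasSmallSubspaces`).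

If every `H_ε` is infinite dimensional, these subspaces serve, because each `Aᵢ` has norm at most
`ε` on `H_ε`, and so `A` has norm at most `N ε` there.

Conversely, suppose `H_ε` is finite dimensional for some `ε`. The projections `Pᵢ = 1 - E_{Aᵢ}([-ε,
ε])` factor through `Aᵢ` on either side, so `Pᵢ Pⱼ` is compact for `i ≠ j`. Hence the map `x ↦ (Pᵢ
x)ᵢ` into the direct sum of the ranges has a Gram operator of the form identity plus compact, and is
bounded below on the complement of its kernel. This gives `‖x‖ ≤ C ∑ ‖Aᵢ x‖` on `H_εᗮ`
(`exists_norm_le_sum_norm_of_commonSpectralSubspace`). On the other hand `Aᵢ² = Aᵢ A - ∑_{j ≠ i} Aᵢ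
Aⱼ`, and the compact cross terms are small off a finite-dimensional space. So where `A` is small on
an infinite-dimensional space there is a nonzero `x ∈ H_εᗮ` on which all `Aᵢ` are small, a
contradiction. -/

namespace SpectralSum

variable {H : Type*} [NormedAddCommGroup H] [InnerProductSpace ℂ H] [CompleteSpace H]

/-! ### Spectral subspaces of `[-ε, ε]` through continuous functional calculus. -/

section FunctionalCalculus

/-- The part of `t` that sticks out of the interval `[-ε, ε]`. -/
def excess (ε t : ℝ) : ℝ := t - max (-ε) (min t ε)

/-- A continuous function that agrees with `t ↦ t⁻¹` where `ε ≤ |t|`. -/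
noncomputable def truncatedInv (ε t : ℝ) : ℝ := t / max (t ^ 2) (ε ^ 2)

@[fun_prop]
theorem continuous_excess (ε : ℝ) : Continuous (excess ε) := by
  unfold excess; fun_prop

theorem continuous_truncatedInv {ε : ℝ} (hε : 0 < ε) : Continuous (truncatedInv ε) := by
  unfold truncatedInv
  refine continuous_id.div (by fun_prop) fun t => ?_
  have : 0 < max (t ^ 2) (ε ^ 2) := lt_max_of_lt_right (by positivity)
  exact this.ne'

theorem excess_eq_zero_iff {ε : ℝ} (hε : 0 < ε) (t : ℝ) : excess ε t = 0 ↔ t ∈ Icc (-ε) ε := by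
  unfold excess
  rw [mem_Icc]
  constructor
  · intro h
    have h1 : t = max (-ε) (min t ε) := by linarith
    refine ⟨h1 ▸ le_max_left _ _, ?_⟩
    rw [h1]
    exact max_le (by linarith) (min_le_right _ _)
  · rintro ⟨h1, h2⟩
    rw [min_eq_left h2, max_eq_right h1, sub_self]

theorem truncatedInv_mul_self {ε t : ℝ} (hε : 0 < ε) (ht : ε ≤ |t|) :
    truncatedInv ε t * t = 1 := by
  have h : ε ^ 2 ≤ t ^ 2 := by
    rw [← sq_abs t]; gcongr
  have h0 : t ^ 2 ≠ 0 := (lt_of_lt_of_le (by positivity) h).ne'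
  rw [truncatedInv, max_eq_left h, div_mul_eq_mul_div, ← pow_two, div_self h0]

theorem abs_truncatedInv_le {ε : ℝ} (hε : 0 < ε) (t : ℝ) : |truncatedInv ε t| ≤ ε⁻¹ := by
  have h0 : 0 < max (t ^ 2) (ε ^ 2) := lt_max_of_lt_right (by positivity)
  rw [truncatedInv, abs_div, abs_of_pos h0, div_le_iff₀ h0, ← div_eq_inv_mul, le_div_iff₀ hε]
  rcases le_total |t| ε with h | h
  · exact le_trans (by nlinarith [abs_nonneg t]) (le_max_right _ _)
  · exact le_trans (by nlinarith [abs_nonneg t, sq_abs t]) (le_max_left _ _)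

theorem cfc_apply_cfc_apply (A : H →L[ℂ] H) {f g : ℝ → ℝ} (hf : Continuous f)
    (hg : Continuous g) (x : H) :
    cfc f A (cfc g A x) = cfc (fun t => f t * g t) A x := by
  rw [cfc_mul f g A hf.continuousOn hg.continuousOn]; rfl

theorem cfc_apply_eq_zero_of_eqOn (A : H →L[ℂ] H) {f : ℝ → ℝ}
    (h : ∀ t ∈ spectrum ℝ A, f t = 0) : cfc f A = 0 := by
  rw [cfc_congr (g := fun _ => 0) h]
  exact cfc_const_zero ℝ A

/-- The spectral subspace of `[-ε, ε]` as the kernel of a continuous function of the operator. -/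
theorem range_proj_Icc_eq_ker (A : H →L[ℂ] H) (hA : IsSelfAdjoint A) {ε : ℝ} (hε : 0 < ε) :
    LinearMap.range ((spectralMeasure A hA).proj (Icc (-ε) ε)).toLinearMap =
      LinearMap.ker (cfc (excess ε) A).toLinearMap := by
  set S : Set (spectrum ℝ A) := Subtype.val ⁻¹' Icc (-ε) ε with hS
  have hSm : MeasurableSet S := measurable_subtype_coe measurableSet_Icc
  have hrep : Represents A hA S ((spectralMeasure A hA).proj (Icc (-ε) ε)) :=
    represents_spectralProjection A hA S hSm
  set E := (spectralMeasure A hA).proj (Icc (-ε) ε) with hE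
  ext x
  have h1 : x ∈ LinearMap.range E.toLinearMap ↔ (1 - E) x = 0 := by
    rw [_root_.sub_apply, one_apply_eq_self, sub_eq_zero]
    constructor
    · rintro ⟨y, rfl⟩
      exact (DFunLike.congr_fun hrep.1.isIdempotentElem y).symm
    · intro h
      exact ⟨x, h.symm⟩
  have hrep' : Represents A hA Sᶜ (1 - E) := by
    refine ⟨hrep.1.one_sub, fun x => ?_⟩
    rw [_root_.sub_apply, inner_sub_left, hrep.2, (represents_univ A hA).2,
      measureReal_compl hSm]
    push_cast
    rfl
  -- Both memberships say that the scalar spectral measure `μ_x` gives no mass to the complement of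
  -- `[-ε, ε]`: `‖(1 - E) x‖²` is that mass, and `‖excess(A) x‖²` is the integral of `excess²`,
  -- which vanishes exactly on the interval.
  have h2 : (1 - E) x = 0 ↔ (scalarSpectralMeasure A hA x) Sᶜ = 0 := by
    rw [← norm_eq_zero, ← sq_eq_zero_iff, hrep'.norm_sq, measureReal_eq_zero_iff]
  have h3 : x ∈ LinearMap.ker (cfc (excess ε) A).toLinearMap ↔
      (scalarSpectralMeasure A hA x) Sᶜ = 0 := by
    let f : C(spectrum ℝ A, ℝ) := ⟨fun t => excess ε t, by fun_prop⟩
    have hf : cfc (excess ε) A = cfcHom hA f :=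
      cfc_apply (excess ε) A hA (continuous_excess ε).continuousOn
    change cfc (excess ε) A x = 0 ↔ _
    rw [hf, ← norm_eq_zero, ← sq_eq_zero_iff, ← integral_sq_scalarSpectralMeasure,
      integral_eq_zero_iff_of_nonneg (fun t => sq_nonneg _)
        ((f.continuous.pow 2).integrable_of_hasCompactSupport
          (HasCompactSupport.of_compactSpace _)), Filter.EventuallyEq, ae_iff]
    congr! 2
    ext t
    change ¬ (excess ε t) ^ 2 = 0 ↔ _
    rw [sq_eq_zero_iff, excess_eq_zero_iff hε]
    rfl
  rw [h1, h2, h3]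

/-- The identity function is `excess ε` plus the clamp to `[-ε, ε]`, so on this kernel `A` acts as
its clamp, an operator of norm at most `ε`. -/
theorem norm_apply_le_of_mem_ker_excess (A : H →L[ℂ] H) (hA : IsSelfAdjoint A) {ε : ℝ}
    (hε : 0 < ε) {x : H} (hx : cfc (excess ε) A x = 0) : ‖A x‖ ≤ ε * ‖x‖ := by
  have h : A = cfc (excess ε) A + cfc (fun t => max (-ε) (min t ε)) A := by
    rw [← cfc_add A (excess ε) (fun t => max (-ε) (min t ε))
      (continuous_excess ε).continuousOn (by fun_prop)]
    conv_lhs => rw [← cfc_id ℝ A]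
    congr 1
    ext t
    simp [excess]
  have h2 : A x = cfc (fun t => max (-ε) (min t ε)) A x := by
    conv_lhs => rw [h]
    rw [_root_.add_apply, hx, zero_add]
  rw [h2]
  refine ContinuousLinearMap.le_of_opNorm_le _ (norm_cfc_le hε.le fun t _ => ?_) x
  rw [Real.norm_eq_abs, abs_le]
  exact ⟨le_max_left _ _, max_le (by linarith) (min_le_right _ _)⟩

/-- Off the spectral subspace of `[-ε, ε]` the truncated inverse is a left inverse. -/
theorem excess_cfc_truncatedInv (A : H →L[ℂ] H) (hA : IsSelfAdjoint A) {ε : ℝ} (hε : 0 < ε)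
    (x : H) : cfc (excess ε) A (x - cfc (truncatedInv ε) A (A x)) = 0 := by
  have hr := continuous_truncatedInv hε
  have h1 : cfc (truncatedInv ε) A (A x) = cfc (fun t => truncatedInv ε t * t) A x := by
    have := cfc_apply_cfc_apply A hr continuous_id x
    rw [cfc_id ℝ A] at this
    exact this
  rw [map_sub, h1, cfc_apply_cfc_apply A (continuous_excess ε) (by fun_prop), sub_eq_zero]
  congr 1
  congr 1
  ext t
  -- Pointwise, either the factor `excess` vanishes or `|t| > ε`, where the truncated inverse is the
  -- true inverse.
  by_cases ht : excess ε t = 0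
  · simp [ht]
  · rw [truncatedInv_mul_self hε, mul_one]
    by_contra! h
    exact ht ((excess_eq_zero_iff hε t).2 (abs_le.1 h.le))

end FunctionalCalculus

/-! ### A Weyl criterion for `0` in the essential spectrum. -/

section Weyl

/-- `A` is arbitrarily small on infinite-dimensional subspaces. -/
def HasSmallSubspaces (A : H →L[ℂ] H) : Prop :=
  ∀ δ : ℝ, 0 < δ → ∃ L : Submodule ℂ H, ¬ FiniteDimensional ℂ L ∧ ∀ x ∈ L, ‖A x‖ ≤ δ * ‖x‖

theorem infinite_spectrum_inter_Ioo (A : H →L[ℂ] H) (hA : IsSelfAdjoint A)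
    (h : AccPt (0 : ℂ) (𝓟 (spectrum ℂ A))) {δ : ℝ} (hδ : 0 < δ) :
    (spectrum ℝ A ∩ Ioo (-δ) δ).Infinite := by
  intro hfin
  have h1 : AccPt (0 : ℂ) (𝓟 (Metric.ball 0 δ ∩ spectrum ℂ A)) :=
    h.nhds_inter (Metric.ball_mem_nhds 0 hδ)
  have h2 : (Metric.ball 0 δ ∩ spectrum ℂ A).Finite := by
    refine (hfin.image (algebraMap ℝ ℂ)).subset ?_
    rintro z ⟨hz, hzA⟩
    have hre := hA.mem_spectrum_eq_re hzA
    refine ⟨z.re, ⟨?_, ?_⟩, hre.symm⟩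
    · rw [hre] at hzA
      exact (spectrum.algebraMap_mem_iff ℂ).1 hzA
    · rw [mem_ball_zero_iff] at hz
      exact abs_lt.1 ((Complex.abs_re_le_norm z).trans_lt hz)
  -- A finite set without `0` is closed, so its complement is a neighbourhood of `0`.
  obtain ⟨y, ⟨hyU, hyS⟩, hy0⟩ := accPt_iff_nhds.1 h1 _
    ((h2.subset (sdiff_subset (t := {0}))).isClosed.isOpen_compl.mem_nhds (by simp))
  exact hyU ⟨hyS, hy0⟩

/-- A finite-dimensional kernel would be `A`-invariant, so some nonzero polynomial `p` would have
`p(A) = 0` on it. A bump `f` supported in `[-δ, δ]` has `f(A)` mapping into the kernel, so `p f`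
vanishes on the spectrum and `p` has infinitely many roots. -/
theorem not_finiteDimensional_ker_excess (A : H →L[ℂ] H) (hA : IsSelfAdjoint A) {δ : ℝ}
    (hδ : 0 < δ) (hinf : (spectrum ℝ A ∩ Ioo (-δ) δ).Infinite) :
    ¬ FiniteDimensional ℂ (LinearMap.ker (cfc (excess δ) A).toLinearMap) := by
  intro hfd
  set L := LinearMap.ker (cfc (excess δ) A).toLinearMap with hL
  have hinv : ∀ x ∈ L, A x ∈ L := by
    intro x hx
    have hc : Commute A (cfc (excess δ) A) := ((Commute.refl A).cfc_real _).symm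
    change cfc (excess δ) A (A x) = 0
    have := DFunLike.congr_fun hc.eq x
    change A (cfc (excess δ) A x) = cfc (excess δ) A (A x) at this
    rw [← this, show cfc (excess δ) A x = 0 from hx, map_zero]
  -- Real scalars make the minimal polynomial real, as the real functional calculus requires.
  let B : L →ₗ[ℝ] L := (A.toLinearMap.restrict hinv).restrictScalars ℝ
  have hB : ∀ p : Polynomial ℝ, ∀ x : L,
      ((Polynomial.aeval B p x : L) : H) = Polynomial.aeval A p (x : H) := by
    intro p
    induction p using Polynomial.induction_on' with
    | add p q hp hq => intro x; simp [hp, hq]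
    | monomial n a =>
      intro x
      have hpow : ∀ n : ℕ, (((B ^ n) x : L) : H) = (A ^ n) (x : H) := by
        intro n
        induction n with
        | zero => simp
        | succ n ih =>
          rw [pow_succ', pow_succ']
          change A (((B ^ n) x : L) : H) = A ((A ^ n) (x : H))
          rw [ih]
      rw [Polynomial.aeval_monomial, Polynomial.aeval_monomial, ← Algebra.smul_def,
        ← Algebra.smul_def]
      change a • (((B ^ n) x : L) : H) = a • ((A ^ n) (x : H))
      rw [hpow]
  have hfr : FiniteDimensional ℝ L := FiniteDimensional.complexToReal L
  set p := minpoly ℝ B with hp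
  have hp0 : p ≠ 0 := minpoly.ne_zero (Algebra.IsIntegral.isIntegral B)
  have hpL : ∀ x ∈ L, Polynomial.aeval A p x = 0 := by
    intro x hx
    rw [← hB p ⟨x, hx⟩, minpoly.aeval]
    rfl
  let f : ℝ → ℝ := fun t => max (δ - |t|) 0
  have hf : Continuous f := by fun_prop
  have hfL : ∀ x, cfc f A x ∈ L := by
    intro x
    change cfc (excess δ) A (cfc f A x) = 0
    rw [cfc_apply_cfc_apply A (continuous_excess δ) hf, cfc_apply_eq_zero_of_eqOn]
    · rfl
    · intro t _
      rcases le_total |t| δ with h | h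
      · rw [(excess_eq_zero_iff hδ t).2 (abs_le.1 h), zero_mul]
      · rw [show f t = 0 from max_eq_right (by linarith), mul_zero]
  have hzero : cfc (fun t => p.eval t * f t) A = cfc (fun _ => (0 : ℝ)) A := by
    rw [cfc_const_zero]
    ext x
    rw [← cfc_apply_cfc_apply A p.continuous hf, cfc_polynomial p A hA, hpL _ (hfL x)]
    rfl
  have heq := eqOn_of_cfc_eq_cfc hzero (hf := by fun_prop)
  refine hp0 (Polynomial.eq_zero_of_infinite_isRoot p (hinf.mono ?_))
  rintro t ⟨ht, ht1, ht2⟩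
  have h := heq ht
  have hft : f t ≠ 0 := by
    have : 0 < δ - |t| := by rw [sub_pos, abs_lt]; exact ⟨ht1, ht2⟩
    exact (lt_max_of_lt_left this).ne'
  exact (mul_eq_zero.1 h).resolve_right hft

theorem hasSmallSubspaces_of_mem_essentialSpectrum (A : H →L[ℂ] H) (hA : IsSelfAdjoint A)
    (h : (0 : ℂ) ∈ essentialSpectrum A) : HasSmallSubspaces A := by
  intro δ hδ
  rcases h.2 with h | h
  · exact ⟨_, not_finiteDimensional_ker_excess A hA hδ (infinite_spectrum_inter_Ioo A hA h hδ),
      fun x hx => norm_apply_le_of_mem_ker_excess A hA hδ hx⟩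
  · refine ⟨_, h, fun x hx => ?_⟩
    have : A x = 0 := by simpa using hx
    rw [this, norm_zero]
    positivity

theorem exists_ne_zero_of_not_finiteDimensional {V : Type*} [AddCommGroup V] [Module ℂ V]
    {L : Submodule ℂ V}
    (hL : ¬ FiniteDimensional ℂ L) : ∃ x ∈ L, x ≠ 0 := by
  by_contra! h
  have : L = ⊥ := (Submodule.eq_bot_iff L).2 h
  subst this
  exact hL inferInstance

/-- An inverse would bound `A` below, so `0` is in the spectrum. If `0` were isolated with
finite-dimensional kernel, the spectral gap would make an infinite-dimensional subspace embed into
that kernel. -/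
theorem mem_essentialSpectrum_of_hasSmallSubspaces (A : H →L[ℂ] H) (hA : IsSelfAdjoint A)
    (h : HasSmallSubspaces A) : (0 : ℂ) ∈ essentialSpectrum A := by
  constructor
  · rw [spectrum.zero_mem_iff]
    rintro ⟨u, hu⟩
    let C := ‖(↑u⁻¹ : H →L[ℂ] H)‖
    obtain ⟨L, hL, hs⟩ := h (C + 1)⁻¹ (by positivity)
    obtain ⟨x, hx, hx0⟩ := exists_ne_zero_of_not_finiteDimensional hL
    have h1 : x = (↑u⁻¹ : H →L[ℂ] H) (A x) := by
      have := DFunLike.congr_fun u.inv_mul x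
      rw [hu] at this
      exact this.symm
    have h2 : ‖x‖ ≤ C * ((C + 1)⁻¹ * ‖x‖) := by
      conv_lhs => rw [h1]
      exact (ContinuousLinearMap.le_opNorm _ _).trans
        (mul_le_mul_of_nonneg_left (hs x hx) (norm_nonneg _))
    have h3 : 0 < ‖x‖ := norm_pos_iff.2 hx0
    have hC : 0 ≤ C := norm_nonneg _
    rw [← mul_assoc, ← div_eq_mul_inv] at h2
    have h4 : C / (C + 1) < 1 := by rw [div_lt_one (by positivity)]; linarith
    nlinarith
  · by_contra! hcon
    obtain ⟨hacc, hfd⟩ := hcon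
    rw [accPt_iff_nhds] at hacc
    push Not at hacc
    obtain ⟨U, hU, hUs⟩ := hacc
    obtain ⟨r, hr, hrU⟩ := Metric.mem_nhds_iff.1 hU
    have hgap : ∀ t ∈ spectrum ℝ A, t ≠ 0 → r ≤ |t| := by
      intro t ht ht0
      by_contra! hlt
      have h1 : (t : ℂ) ∈ U := hrU (by simpa using hlt)
      have h2 : (t : ℂ) ∈ spectrum ℂ A := (spectrum.algebraMap_mem_iff ℂ).2 ht
      exact ht0 (by exact_mod_cast hUs _ ⟨h1, h2⟩)
    have hc := continuous_truncatedInv hr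
    -- On the spectrum `1 - truncatedInv r t * t` is the indicator of `{0}`, thanks to the gap `r`;
    -- so `q` maps into `ker A`.
    let q : H →L[ℂ] H := 1 - cfc (truncatedInv r) A * A
    have hq : A * q = 0 := by
      have e : A * q = cfc (fun t => t * (1 - truncatedInv r t * t)) A := by
        rw [cfc_mul (fun t => t) _ A (by fun_prop) (by fun_prop), cfc_sub (fun _ => 1) _ A
          (by fun_prop) (by fun_prop), cfc_mul _ (fun t => t) A (by fun_prop) (by fun_prop),
          cfc_const_one ℝ A, cfc_id' ℝ A]
      rw [e]
      refine cfc_apply_eq_zero_of_eqOn A fun t ht => ?_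
      by_cases h0 : t = 0
      · simp [h0]
      · rw [truncatedInv_mul_self hr (hgap t ht h0), sub_self, mul_zero]
    -- The truncated inverse has norm at most `r⁻¹`, so the bound `r / 2` makes `q` injective on
    -- `L`.
    obtain ⟨L, hL, hs⟩ := h (r / 2) (by positivity)
    apply hL
    let φ : L →ₗ[ℂ] LinearMap.ker (A - (0 : ℂ) • (1 : H →L[ℂ] H)).toLinearMap :=
      (q.toLinearMap ∘ₗ L.subtype).codRestrict _ fun x => by
        have := DFunLike.congr_fun hq (x : H)
        change (A - (0 : ℂ) • (1 : H →L[ℂ] H)) (q x) = 0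
        rw [zero_smul, sub_zero]
        exact this
    have hφ : Function.Injective φ := by
      rw [← LinearMap.ker_eq_bot, Submodule.eq_bot_iff]
      intro x hx
      have h0 : q x = 0 := congrArg Subtype.val (LinearMap.mem_ker.1 hx)
      have h1 : (x : H) = cfc (truncatedInv r) A (A x) := sub_eq_zero.1 h0
      have h2 : ‖(x : H)‖ ≤ r⁻¹ * (r / 2 * ‖(x : H)‖) := by
        conv_lhs => rw [h1]
        refine (ContinuousLinearMap.le_of_opNorm_le _ (norm_cfc_le (by positivity)
          fun t _ => abs_truncatedInv_le hr t) _).trans ?_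
        exact mul_le_mul_of_nonneg_left (hs x x.2) (by positivity)
      have h3 : r⁻¹ * (r / 2 * ‖(x : H)‖) = ‖(x : H)‖ / 2 := by field_simp
      have h4 : ‖(x : H)‖ = 0 := le_antisymm (by linarith) (norm_nonneg _)
      exact Subtype.ext (norm_eq_zero.1 h4)
    exact FiniteDimensional.of_injective φ hφ

end Weyl

/-! ### Compact operators and compact perturbations of the identity. -/

section Compact

variable {X : Type*} [NormedAddCommGroup X] [InnerProductSpace ℂ X] [CompleteSpace X]

/-- A compact operator is small on a subspace of finite codimension. -/
theorem exists_finiteDimensional_norm_le_of_isCompactOperator (K : X →L[ℂ] H)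
    (hK : IsCompactOperator K) {δ : ℝ} (hδ : 0 < δ) :
    ∃ M : Submodule ℂ X, FiniteDimensional ℂ M ∧ ∀ x ∈ Mᗮ, ‖K x‖ ≤ δ * ‖x‖ := by
  obtain ⟨C, hC, hsub⟩ :=
    IsCompactOperator.image_closedBall_subset_compact (f := K.toLinearMap) hK 1
  obtain ⟨t, htf, ht⟩ := Metric.totallyBounded_iff.1 hC.totallyBounded δ hδ
  -- With `t` a finite `δ`-net of the image of the unit ball, `x ⟂ K† t` means `K x ⟂ t`. A unit `u`
  -- then has `K u` within `δ` of some `y ⟂ K u`, whence `‖K u‖² = ⟪K u - y, K u⟫ ≤ δ ‖K u‖`.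
  refine ⟨Submodule.span ℂ (K.adjoint '' t), FiniteDimensional.span_of_finite ℂ (htf.image _),
    fun x hx => ?_⟩
  rcases eq_or_ne x 0 with rfl | hx0
  · simp
  have hxn : 0 < ‖x‖ := norm_pos_iff.2 hx0
  set u : X := ((‖x‖⁻¹ : ℝ) : ℂ) • x with hu
  have hun : ‖u‖ = 1 := by
    rw [hu, norm_smul, Complex.norm_real, norm_inv, norm_norm, inv_mul_cancel₀ hxn.ne']
  have hux : x = ((‖x‖ : ℝ) : ℂ) • u := by
    rw [hu, smul_smul, ← Complex.ofReal_mul, mul_inv_cancel₀ hxn.ne', Complex.ofReal_one, one_smul]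
  have huM : u ∈ (Submodule.span ℂ (K.adjoint '' t))ᗮ := Submodule.smul_mem _ _ hx
  have hKu : K u ∈ C := hsub ⟨u, by simp [hun], rfl⟩
  obtain ⟨y, hyt, hy⟩ := mem_iUnion₂.1 (ht hKu)
  have horth : ⟪y, K u⟫_ℂ = 0 := by
    rw [← ContinuousLinearMap.adjoint_inner_left]
    exact (Submodule.mem_orthogonal _ _).1 huM _ (Submodule.subset_span ⟨y, hyt, rfl⟩)
  have hle : ‖K u‖ ≤ δ := by
    have h1 : ‖K u‖ * ‖K u‖ ≤ δ * ‖K u‖ := by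
      have h2 : ⟪K u - y, K u⟫_ℂ = ((‖K u‖ * ‖K u‖ : ℝ) : ℂ) := by
        rw [inner_sub_left, horth, sub_zero, inner_self_eq_norm_sq_to_K, pow_two]
        simp
      have h3 := norm_inner_le_norm (𝕜 := ℂ) (K u - y) (K u)
      rw [h2, Complex.norm_real, Real.norm_of_nonneg (by positivity)] at h3
      refine h3.trans (mul_le_mul_of_nonneg_right ?_ (norm_nonneg _))
      rw [← dist_eq_norm]
      exact (Metric.mem_ball.1 hy).le
    by_contra! hlt
    nlinarith
  rw [hux, map_smul, norm_smul, norm_smul, hun, mul_one, mul_comm]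
  exact mul_le_mul_of_nonneg_right hle (norm_nonneg _)

/-- An infinite-dimensional subspace meets the orthogonal complement of every
finite-dimensional one. -/
theorem exists_mem_orthogonal_of_not_finiteDimensional {V : Type*} [NormedAddCommGroup V]
    [InnerProductSpace ℂ V] {L M : Submodule ℂ V}
    (hL : ¬ FiniteDimensional ℂ L) [FiniteDimensional ℂ M] : ∃ x ∈ L, x ∈ Mᗮ ∧ x ≠ 0 := by
  by_contra! h
  apply hL
  let φ : L →ₗ[ℂ] M := M.orthogonalProjectionOnto.toLinearMap ∘ₗ L.subtype
  refine FiniteDimensional.of_injective φ ?_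
  rw [← LinearMap.ker_eq_bot, Submodule.eq_bot_iff]
  intro x hx
  have h0 : M.orthogonalProjectionOnto (x : V) = 0 := hx
  exact Subtype.ext (h x x.2 (Submodule.orthogonalProjectionOnto_eq_zero_iff.1 h0))

/-- If `B B†` is a compact perturbation of the identity then `B B†` is bounded below on the
orthogonal complement of `ker B†`. -/
theorem exists_le_norm_comp_adjoint (B : H →L[ℂ] X)
    (hB : IsCompactOperator (B ∘L B.adjoint - 1 : X →L[ℂ] X)) :
    ∃ c : ℝ, 0 < c ∧ ∀ z ∈ B.adjoint.kerᗮ, c * ‖z‖ ≤ ‖B (B.adjoint z)‖ := by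
  by_contra! hcon
  set K : X →L[ℂ] X := B ∘L B.adjoint - 1 with hK
  -- Failure gives unit vectors `u n` in `(ker B†)ᗮ` with `B B† u n → 0`. As `u n = B B† u n - K (u
  -- n)`, a subsequence converges, to a unit vector lying both in `(ker B†)ᗮ` and in `ker B B† = ker
  -- B†`.
  have hunit : ∀ n : ℕ, ∃ u ∈ B.adjoint.kerᗮ, ‖u‖ = 1 ∧ ‖B (B.adjoint u)‖ ≤ 1 / ((n : ℝ) + 1) := by
    intro n
    obtain ⟨z, hz, hlt⟩ := hcon (1 / ((n : ℝ) + 1)) (by positivity)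
    have hz0 : 0 < ‖z‖ := by
      rw [norm_pos_iff]; rintro rfl; simp at hlt
    refine ⟨((‖z‖⁻¹ : ℝ) : ℂ) • z, Submodule.smul_mem _ _ hz, ?_, ?_⟩
    · rw [norm_smul, Complex.norm_real, norm_inv, norm_norm, inv_mul_cancel₀ hz0.ne']
    · rw [map_smul, map_smul, norm_smul, Complex.norm_real, norm_inv, norm_norm,
        inv_mul_le_iff₀ hz0, mul_comm]
      exact hlt.le
  choose u hu hu1 hus using hunit
  obtain ⟨C, hC, hsub⟩ :=
    IsCompactOperator.image_closedBall_subset_compact (f := K.toLinearMap) hB 1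
  obtain ⟨y, -, φ, hφ, hlim⟩ := hC.tendsto_subseq (x := fun n => K (u n))
    fun n => hsub ⟨u n, by simp [hu1], rfl⟩
  have hG : Tendsto (fun n => B (B.adjoint (u n))) atTop (𝓝 0) :=
    squeeze_zero_norm hus tendsto_one_div_add_atTop_nhds_zero_nat
  have hu_lim : Tendsto (fun n => u (φ n)) atTop (𝓝 (-y)) := by
    have h := (hG.comp hφ.tendsto_atTop).sub hlim
    rw [zero_sub] at h
    refine h.congr fun n => ?_
    simp [hK]
  have hy1 : ‖-y‖ = 1 :=
    tendsto_nhds_unique hu_lim.norm (by simp [hu1])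
  have hyM : -y ∈ B.adjoint.kerᗮ :=
    (Submodule.isClosed_orthogonal _).mem_of_tendsto hu_lim (Eventually.of_forall fun n => hu _)
  have hy0 : B (B.adjoint (-y)) = 0 :=
    tendsto_nhds_unique (((B ∘L B.adjoint).continuous.tendsto _).comp hu_lim)
      (hG.comp hφ.tendsto_atTop)
  have hyk : -y ∈ B.adjoint.ker := by
    have h : ⟪B.adjoint (-y), B.adjoint (-y)⟫_ℂ = 0 := by
      rw [ContinuousLinearMap.adjoint_inner_left, hy0, inner_zero_right]
    exact inner_self_eq_zero.1 h
  have : -y = 0 := inner_self_eq_zero.1 ((Submodule.mem_orthogonal _ _).1 hyM _ hyk)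
  rw [this, norm_zero] at hy1
  exact zero_ne_one hy1

/-- `(ker B)ᗮ` is the closure of the range of `B†`, and the inequality is a closed condition. So
take `x = B† z`, with `z ∈ (ker B†)ᗮ` without loss, and bound `‖z‖` by `‖B B† z‖ = ‖B x‖`. -/
theorem exists_norm_le_of_mem_orthogonal_ker (B : H →L[ℂ] X)
    (hB : IsCompactOperator (B ∘L B.adjoint - 1 : X →L[ℂ] X)) :
    ∃ C : ℝ, 0 ≤ C ∧ ∀ x ∈ B.kerᗮ, ‖x‖ ≤ C * ‖B x‖ := by
  obtain ⟨c, hc, hle⟩ := exists_le_norm_comp_adjoint B hB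
  refine ⟨‖B.adjoint‖ * c⁻¹, by positivity, fun x hx => ?_⟩
  rw [ContinuousLinearMap.orthogonal_ker] at hx
  have hcl : IsClosed {x : H | ‖x‖ ≤ ‖B.adjoint‖ * c⁻¹ * ‖B x‖} :=
    isClosed_le (by fun_prop) (by fun_prop)
  refine closure_minimal (s := (B.adjoint.range : Set H)) ?_ hcl hx
  rintro _ ⟨z, rfl⟩
  have hcomplete : CompleteSpace B.adjoint.ker := B.adjoint.isClosed_ker.completeSpace_coe
  obtain ⟨f, hf, w, hw, rfl⟩ := B.adjoint.ker.exists_add_mem_mem_orthogonal z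
  change ‖B.adjoint (f + w)‖ ≤ ‖B.adjoint‖ * c⁻¹ * ‖B (B.adjoint (f + w))‖
  rw [map_add, show B.adjoint f = 0 from hf, zero_add, mul_assoc]
  refine (B.adjoint.le_opNorm w).trans (mul_le_mul_of_nonneg_left ?_ (norm_nonneg _))
  rw [← div_eq_inv_mul, le_div_iff₀ hc, mul_comm]
  exact hle w hw

end Compact

/-! ### Projections with compact pairwise products. -/

section Projections

theorem isCompactOperator_sum {ι E F : Type*} [NormedAddCommGroup E] [NormedSpace ℂ E]
    [NormedAddCommGroup F] [NormedSpace ℂ F] (s : Finset ι) (T : ι → E →L[ℂ] F)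
    (hT : ∀ i ∈ s, IsCompactOperator (T i)) : IsCompactOperator (∑ i ∈ s, T i : E →L[ℂ] F) :=
  Submodule.sum_mem (compactOperator (RingHom.id ℂ) E F) hT

/-- Finitely many projections with compact pairwise products are jointly bounded below on the
orthogonal complement of their common kernel. -/
theorem exists_norm_le_sum_norm_of_projections {ι : Type*} [Fintype ι] (P : ι → H →L[ℂ] H)
    (hP : ∀ i, IsStarProjection (P i)) (hc : ∀ i j, i ≠ j → IsCompactOperator (P i ∘L P j)) :
    ∃ C : ℝ, 0 ≤ C ∧ ∀ x ∈ (⨅ i, LinearMap.ker (P i).toLinearMap)ᗮ,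
      ‖x‖ ≤ C * ∑ i, ‖P i x‖ := by
  classical
  have hcomplete : ∀ i, CompleteSpace (LinearMap.range (P i).toLinearMap) := fun i =>
    (ContinuousLinearMap.IsIdempotentElem.isClosed_range
      (hP i).isIdempotentElem).completeSpace_coe
  -- `X` is the Hilbert sum of the ranges and `π i` reads off the `i`-th coordinate in `H`. The sum
  -- `B` of the adjoints is then `x ↦ (Pᵢ x)ᵢ`, and `B†` adds up the coordinates.
  let X := PiLp 2 (fun i => LinearMap.range (P i).toLinearMap)
  let π : ι → X →L[ℂ] H := fun i =>
    (LinearMap.range (P i).toLinearMap).subtypeL ∘L PiLp.proj 2 _ i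
  have hPP : ∀ i, P i ∘L P i = P i := fun i => (hP i).isIdempotentElem
  have hPπ : ∀ i, P i ∘L π i = π i := by
    intro i
    ext z
    obtain ⟨y, hy⟩ := (z i).2
    change P i (z i : H) = z i
    rw [← hy]
    exact DFunLike.congr_fun (hPP i) y
  have hπP : ∀ i, (π i).adjoint ∘L P i = (π i).adjoint := by
    intro i
    have h := congrArg ContinuousLinearMap.adjoint (hPπ i)
    rw [ContinuousLinearMap.adjoint_comp] at h
    rwa [show (P i).adjoint = P i from (hP i).isSelfAdjoint] at h
  have hone : ∑ i, (π i).adjoint ∘L π i = 1 := by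
    ext1 z
    refine ext_inner_right ℂ fun w => ?_
    rw [_root_.sum_apply, sum_inner]
    simp only [ContinuousLinearMap.comp_apply, ContinuousLinearMap.adjoint_inner_left]
    rw [one_apply_eq_self, PiLp.inner_apply]
    rfl
  let B : H →L[ℂ] X := ∑ i, (π i).adjoint
  have hBadj : B.adjoint = ∑ i, π i := by
    simp only [B, map_sum, ContinuousLinearMap.adjoint_adjoint]
  -- The diagonal blocks of the Gram operator sum to the identity; the others factor through `Pᵢ
  -- Pⱼ`.
  have hBB : B ∘L B.adjoint - 1 = ∑ i, ∑ j ∈ Finset.univ.erase i, (π i).adjoint ∘L π j := by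
    rw [hBadj, ← hone, sub_eq_iff_eq_add, ← Finset.sum_add_distrib]
    ext1 z
    simp only [B, ContinuousLinearMap.comp_apply, _root_.sum_apply, map_sum, _root_.add_apply]
    rw [Finset.sum_comm]
    refine Finset.sum_congr rfl fun i _ => ?_
    rw [Finset.sum_erase_add _ _ (Finset.mem_univ i)]
  have hcompact : IsCompactOperator (B ∘L B.adjoint - 1 : X →L[ℂ] X) := by
    rw [hBB]
    refine isCompactOperator_sum _ _ fun i _ => isCompactOperator_sum _ _ fun j hj => ?_
    rw [← hπP i, ← hPπ j]
    exact ((hc i j (Finset.ne_of_mem_erase hj).symm).comp_clm (π j)).clm_comp (π i).adjoint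
  obtain ⟨C, hC0, hC⟩ := exists_norm_le_of_mem_orthogonal_ker B hcompact
  have hker : B.ker ≤ ⨅ i, LinearMap.ker (P i).toLinearMap := by
    intro x hx
    rw [Submodule.mem_iInf]
    intro i
    -- Testing `B x = 0` against `P i x` placed in slot `i` yields `⟪x, P i x⟫ = ‖P i x‖² = 0`.
    have h1 : ⟪x, B.adjoint (PiLp.single 2 i ⟨P i x, x, rfl⟩)⟫_ℂ = 0 := by
      rw [ContinuousLinearMap.adjoint_inner_right, show B x = 0 from hx, inner_zero_left]
    have h2 : B.adjoint (PiLp.single 2 i ⟨P i x, x, rfl⟩) = P i x := by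
      rw [hBadj, _root_.sum_apply, Finset.sum_eq_single i]
      · exact congrArg Subtype.val (PiLp.single_eq_same 2
          (β := fun i => LinearMap.range (P i).toLinearMap) i ⟨P i x, x, rfl⟩)
      · intro j _ hji
        exact congrArg Subtype.val (PiLp.single_eq_of_ne 2
          (β := fun i => LinearMap.range (P i).toLinearMap) hji ⟨P i x, x, rfl⟩)
      · simp
    rw [h2, inner_eq_zero_symm, inner_eq_norm_sq_of_isStarProjection (hP i)] at h1
    simpa using h1
  let D := ∑ i, ‖(π i).adjoint‖
  refine ⟨C * D, by positivity, fun x hx => ?_⟩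
  refine (hC x (Submodule.orthogonal_le hker hx)).trans ?_
  rw [mul_assoc]
  refine mul_le_mul_of_nonneg_left ?_ hC0
  have h1 : B x = ∑ i, (π i).adjoint (P i x) := by
    simp only [B, _root_.sum_apply]
    exact Finset.sum_congr rfl fun i _ => (DFunLike.congr_fun (hπP i) x).symm
  rw [h1, Finset.mul_sum]
  refine norm_sum_le_of_le _ fun i _ => ((π i).adjoint.le_opNorm _).trans ?_
  refine mul_le_mul_of_nonneg_right ?_ (norm_nonneg _)
  exact Finset.single_le_sum (f := fun i => ‖(π i).adjoint‖) (fun _ _ => norm_nonneg _)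
    (Finset.mem_univ i)

end Projections

/-! ### The sum of the `Aᵢ` and the common spectral subspace. -/

section Sum

variable {N : ℕ} (A : Fin N → H →L[ℂ] H) (hA : ∀ i, IsSelfAdjoint (A i))

theorem norm_sum_apply_le_of_mem_commonSpectralSubspace {ε : ℝ} (hε : 0 < ε) {x : H}
    (hx : x ∈ commonSpectralSubspace A hA ε) : ‖(∑ i, A i) x‖ ≤ N * ε * ‖x‖ := by
  rw [commonSpectralSubspace, Submodule.mem_iInf] at hx
  rw [_root_.sum_apply]
  refine (norm_sum_le_of_le (n := fun _ => ε * ‖x‖) _ fun i _ => ?_).trans_eq ?_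
  · have h := hx i
    rw [range_proj_Icc_eq_ker (A i) (hA i) hε] at h
    exact norm_apply_le_of_mem_ker_excess (A i) (hA i) hε h
  · simp [mul_assoc]

theorem hasSmallSubspaces_sum
    (h : ∀ ε : ℝ, 0 < ε → ¬ FiniteDimensional ℂ (commonSpectralSubspace A hA ε)) :
    HasSmallSubspaces (∑ i, A i) := by
  intro δ hδ
  -- The `+ 1` covers `N = 0`.
  have hε : 0 < δ / (N + 1) := by positivity
  refine ⟨_, h _ hε, fun x hx =>
    (norm_sum_apply_le_of_mem_commonSpectralSubspace A hA hε hx).trans ?_⟩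
  refine mul_le_mul_of_nonneg_right ?_ (norm_nonneg x)
  rw [mul_div_assoc', div_le_iff₀ (by positivity)]
  nlinarith

/-- If the products `Aᵢ Aⱼ` are compact, then the `Aᵢ` are jointly bounded below on the orthogonal
complement of `⋂ᵢ E_{Aᵢ}([-ε, ε]) H`. -/
theorem exists_norm_le_sum_norm_of_commonSpectralSubspace
    (hcomp : ∀ i j, i ≠ j → IsCompactOperator (A i ∘L A j)) {ε : ℝ} (hε : 0 < ε) :
    ∃ C : ℝ, 0 ≤ C ∧ ∀ x ∈ (commonSpectralSubspace A hA ε)ᗮ, ‖x‖ ≤ C * ∑ i, ‖A i x‖ := by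
  let E : Fin N → H →L[ℂ] H := fun i => (spectralMeasure (A i) (hA i)).proj (Icc (-ε) ε)
  let P : Fin N → H →L[ℂ] H := fun i => 1 - E i
  let R : Fin N → H →L[ℂ] H := fun i => cfc (truncatedInv ε) (A i)
  have hE : ∀ i, IsStarProjection (E i) := fun i =>
    (spectralMeasure (A i) (hA i)).isStarProjection _ measurableSet_Icc
  have hP : ∀ i, IsStarProjection (P i) := fun i => (hE i).one_sub
  have hker : ∀ i, LinearMap.ker (P i).toLinearMap = LinearMap.range (E i).toLinearMap := by
    intro i
    ext x
    change x - E i x = 0 ↔ _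
    rw [sub_eq_zero]
    constructor
    · intro h
      exact ⟨x, h.symm⟩
    · rintro ⟨y, rfl⟩
      exact (DFunLike.congr_fun (hE i).isIdempotentElem y).symm
  have hPR : ∀ i x, P i x = P i (R i (A i x)) := by
    intro i x
    have h : x - R i (A i x) ∈ LinearMap.ker (P i).toLinearMap := by
      rw [hker, range_proj_Icc_eq_ker (A i) (hA i) hε]
      exact excess_cfc_truncatedInv (A i) (hA i) hε x
    have h' : P i (x - R i (A i x)) = 0 := h
    rwa [map_sub, sub_eq_zero] at h'
  have hPR1 : ∀ i, P i = P i ∘L R i ∘L A i := fun i => by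
    ext x; exact hPR i x
  -- Adjoint of `hPR1`. Together they give `Pᵢ Pⱼ = Pᵢ Rᵢ (Aᵢ Aⱼ) Rⱼ Pⱼ`, which is compact.
  have hPR2 : ∀ i, P i = A i ∘L R i ∘L P i := by
    intro i
    have h := congrArg star (hPR1 i)
    have hR : IsSelfAdjoint (R i) := IsSelfAdjoint.cfc
    change star (P i) = star (P i * (R i * A i)) at h
    rw [star_mul, star_mul, (hP i).isSelfAdjoint.star_eq, (hA i).star_eq, hR.star_eq,
      mul_assoc] at h
    exact h
  have hc : ∀ i j, i ≠ j → IsCompactOperator (P i ∘L P j) := by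
    intro i j hij
    rw [hPR1 i, hPR2 j]
    exact ((hcomp i j hij).comp_clm (R j ∘L P j)).clm_comp (P i ∘L R i)
  obtain ⟨C, hC0, hC⟩ := exists_norm_le_sum_norm_of_projections P hP hc
  let D := ∑ i, ‖P i ∘L R i‖
  refine ⟨C * D, by positivity, fun x hx => ?_⟩
  have hx' : x ∈ (⨅ i, LinearMap.ker (P i).toLinearMap)ᗮ := by
    simp only [hker]
    exact hx
  refine (hC x hx').trans ?_
  rw [mul_assoc]
  refine mul_le_mul_of_nonneg_left ?_ hC0
  rw [Finset.mul_sum]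
  refine Finset.sum_le_sum fun i _ => ?_
  rw [hPR i x]
  refine ((P i ∘L R i).le_opNorm (A i x)).trans (mul_le_mul_of_nonneg_right ?_ (norm_nonneg _))
  exact Finset.single_le_sum (f := fun i => ‖P i ∘L R i‖) (fun _ _ => norm_nonneg _)
    (Finset.mem_univ i)

/-- Where the sum and the compact off-diagonal parts are small, each summand is small. -/
theorem norm_sq_apply_le (i : Fin N) {δ : ℝ} {x : H}
    (hAi : IsSelfAdjoint (A i))
    (h1 : ‖(∑ j, A j) x‖ ≤ δ * ‖x‖)
    (h2 : ‖(∑ j ∈ Finset.univ.erase i, A i ∘L A j) x‖ ≤ δ * ‖x‖) :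
    ‖A i x‖ ^ 2 ≤ (‖A i‖ + 1) * δ * ‖x‖ ^ 2 := by
  have hdec : A i (A i x) = A i ((∑ j, A j) x)
      - (∑ j ∈ Finset.univ.erase i, A i ∘L A j) x := by
    rw [eq_sub_iff_add_eq, _root_.sum_apply, _root_.sum_apply, map_sum,
      ← Finset.add_sum_erase _ _ (Finset.mem_univ i)]
    rfl
  have hn : ‖A i (A i x)‖ ≤ (‖A i‖ + 1) * δ * ‖x‖ := by
    rw [hdec]
    refine (norm_sub_le _ _).trans ?_
    have := ((A i).le_opNorm ((∑ j, A j) x)).trans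
      (mul_le_mul_of_nonneg_left h1 (norm_nonneg (A i)))
    linarith
  -- Self-adjointness turns smallness of `Aᵢ² x` into smallness of `‖Aᵢ x‖²`.
  have hs : ⟪A i (A i x), x⟫_ℂ = ((‖A i x‖ ^ 2 : ℝ) : ℂ) := by
    have : ⟪A i (A i x), x⟫_ℂ = ⟪A i x, A i x⟫_ℂ := hAi.isSymmetric _ _
    rw [this, inner_self_eq_norm_sq_to_K]
    simp
  have h3 := norm_inner_le_norm (𝕜 := ℂ) (A i (A i x)) x
  rw [hs, Complex.norm_real, Real.norm_of_nonneg (by positivity)] at h3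
  refine h3.trans ((mul_le_mul_of_nonneg_right hn (norm_nonneg x)).trans_eq (by ring))

theorem not_finiteDimensional_of_hasSmallSubspaces
    (hcomp : ∀ i j, i ≠ j → IsCompactOperator (A i ∘L A j))
    (h : HasSmallSubspaces (∑ i, A i)) {ε : ℝ} (hε : 0 < ε) :
    ¬ FiniteDimensional ℂ (commonSpectralSubspace A hA ε) := by
  intro hfd
  obtain ⟨C, hC0, hC⟩ := exists_norm_le_sum_norm_of_commonSpectralSubspace A hA hcomp hε
  let b := 1 + ∑ i, ‖A i‖
  have hb : 0 < b := by positivity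
  -- `η` is the target bound for each `‖Aᵢ x‖ / ‖x‖`
  let η : ℝ := 1 / (C * N + 1)
  have hη : 0 < η := by positivity
  -- Chosen so that `(‖A i‖ + 1) * δ ≤ b * δ = η ^ 2` for all `i`.
  let δ : ℝ := η ^ 2 / b
  have hδ : 0 < δ := by positivity
  let K : Fin N → H →L[ℂ] H := fun i => ∑ j ∈ Finset.univ.erase i, A i ∘L A j
  have hK : ∀ i, IsCompactOperator (K i) := fun i =>
    isCompactOperator_sum _ _ fun j hj => hcomp i j (Finset.ne_of_mem_erase hj).symm
  choose M hM hMs using fun i =>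
    exists_finiteDimensional_norm_le_of_isCompactOperator (K i) (hK i) hδ
  obtain ⟨L, hL, hLs⟩ := h δ hδ
  -- Orthogonality to `H_ε` gives the lower bound, orthogonality to each `M i` makes the cross terms
  -- small; finite dimensionality of `H_ε` is what allows both inside `L`.
  obtain ⟨x, hxL, hxM, hx0⟩ := exists_mem_orthogonal_of_not_finiteDimensional
    (M := commonSpectralSubspace A hA ε ⊔ ⨆ i, M i) hL
  have hxn : 0 < ‖x‖ := norm_pos_iff.2 hx0
  have hsmall : ∀ i, ‖A i x‖ ≤ η * ‖x‖ := by
    intro i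
    have hxi : x ∈ (M i)ᗮ :=
      Submodule.orthogonal_le ((le_iSup M i).trans le_sup_right) hxM
    have h1 := norm_sq_apply_le A i (hA i) (hLs x hxL) (hMs i x hxi)
    have h2 : ‖A i‖ + 1 ≤ b := by
      have := Finset.single_le_sum (f := fun i => ‖A i‖) (fun _ _ => norm_nonneg _)
        (Finset.mem_univ i)
      simp only [b]
      linarith
    have h3 : ‖A i x‖ ^ 2 ≤ (η * ‖x‖) ^ 2 := by
      refine h1.trans ?_
      rw [mul_pow]
      refine mul_le_mul_of_nonneg_right ?_ (by positivity)
      refine (mul_le_mul_of_nonneg_right h2 hδ.le).trans_eq ?_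
      exact mul_div_cancel₀ _ hb.ne'
    exact le_of_sq_le_sq h3 (by positivity)
  have h1 := hC x (Submodule.orthogonal_le le_sup_left hxM)
  have h2 : ∑ i, ‖A i x‖ ≤ N * (η * ‖x‖) := by
    refine (Finset.sum_le_sum fun i _ => hsmall i).trans_eq ?_
    simp
  have h3 := h1.trans (mul_le_mul_of_nonneg_left h2 hC0)
  -- The two bounds give `‖x‖ ≤ θ ‖x‖` with `θ = C N η < 1`, impossible for `x ≠ 0`.
  have h4 : C * (N * (η * ‖x‖)) = (C * N / (C * N + 1)) * ‖x‖ := by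
    simp only [η]; ring
  have h5 : C * N / (C * N + 1) < 1 := by
    rw [div_lt_one (by positivity)]; linarith
  rw [h4] at h3
  nlinarith

end Sum

end SpectralSum

theorem mainTheorem1 {H : Type*} [NormedAddCommGroup H] [InnerProductSpace ℂ H] [CompleteSpace H]
    {N : ℕ} (A : Fin N → H →L[ℂ] H) (hA : ∀ i, IsSelfAdjoint (A i))
    (hcomp : ∀ i j, i ≠ j → IsCompactOperator (A i ∘L A j)) :
    (0 : ℂ) ∈ SpectralSum.essentialSpectrum (∑ i, A i) ↔
      ∀ ε : ℝ, 0 < ε →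
        ¬ FiniteDimensional ℂ (SpectralSum.commonSpectralSubspace A hA ε) := by
  have hsum : IsSelfAdjoint (∑ i, A i) := isSelfAdjoint_sum _ fun i _ => hA i
  constructor
  · intro h ε hε
    exact SpectralSum.not_finiteDimensional_of_hasSmallSubspaces A hA hcomp
      (SpectralSum.hasSmallSubspaces_of_mem_essentialSpectrum _ hsum h) hε
  · intro h
    exact SpectralSum.mem_essentialSpectrum_of_hasSmallSubspaces _ hsum
      (SpectralSum.hasSmallSubspaces_sum A hA h)
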